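/- Let $G$ be an infinite group with a finite symmetric generating set $S$ and identity $e$, and let $1<p<\infty$ be real. Let $D_p(G)$ be the space of functions $f\colon G\to\mathbb{C}$ with $\sum_{g\in G}|f(gs^{-1})-f(g)|^p<\infty$ for all $s\in S$, with the norm $$\|f\|_{D_p}=\Bigl(\sum_{s\in S}\sum_{g\in G}|f(gs^{-1})-f(g)|^p+|f(e)|^p\Bigr)^{1/p}.$$ Let $\ell^p(G)\subseteq D_p(G)$ be the space of $p$-summable functions, let $\mathbb{C}\subseteq D_p(G)$ be the constant functions, and let $\mathbb{C}G\subseteq D_p(G)$ be the finitely supported functions. The first reduced $\ell^p$-cohomology of $G$ is $$\bar H^1_{(p)}(G)=D_p(G)\big/\overline{\ell^p(G)\oplus\mathbb{C}},$$ where the closure is taken in $D_p(G)$. Let $BD_p(G)$ be the algebra, under pointwise operations, of the bounded functions in $D_p(G)$; a character of $BD_p(G)$ is a nonzero $\mathbb{C}$-algebra homomorphism $BD_p(G)\to\mathbb{C}$. The $p$-harmonic boundary $\partial_p(G)$ is the set of all characters $x$ of $BD_p(G)$ that are not of the form $f\mapsto f(g)$ with $g\in G$ and that satisfy $x(f)=0$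 for every bounded function $f$ in the closure of $\mathbb{C}G$ in $D_p(G)$. Then $\bar H^1_{(p)}(G)\neq 0$ if and only if $\partial_p(G)$ has more than one element. -/

import Mathlib

noncomputable section

namespace PHarmonic

/-! ### Auxiliary facts on `p`-summable functions -/

theorem summable_rpow_add {α : Type*} {p : ℝ} (hp : 1 ≤ p) {u v : α → ℝ}
    (hu0 : ∀ a, 0 ≤ u a) (hv0 : ∀ a, 0 ≤ v a)
    (hu : Summable fun a => u a ^ p) (hv : Summable fun a => v a ^ p) :
    Summable fun a => (u a + v a) ^ p :=
  Real.summable_Lp_add_of_nonneg hp hu0 hv0 hu hv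

theorem summable_norm_rpow_of_le {α : Type*} {p : ℝ} (hp : 1 ≤ p) {u v : α → ℝ} {w : α → ℂ}
    (hu0 : ∀ a, 0 ≤ u a) (hv0 : ∀ a, 0 ≤ v a)
    (hu : Summable fun a => u a ^ p) (hv : Summable fun a => v a ^ p)
    (h : ∀ a, ‖w a‖ ≤ u a + v a) :
    Summable fun a => ‖w a‖ ^ p :=
  Summable.of_nonneg_of_le (fun _ => by positivity)
    (fun a => Real.rpow_le_rpow (norm_nonneg _) (h a) (by linarith))
    (summable_rpow_add hp hu0 hv0 hu hv)

theorem summable_const_mul_rpow {α : Type*} {p : ℝ} {c : ℝ} (hc : 0 ≤ c) {u : α → ℝ}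
    (hu0 : ∀ a, 0 ≤ u a) (hu : Summable fun a => u a ^ p) :
    Summable fun a => (c * u a) ^ p := by
  simpa only [Real.mul_rpow hc (hu0 _)] using hu.mul_left (c ^ p)

theorem rpow_add_rpow_le {p : ℝ} (hp : 1 ≤ p) {a b c d : ℝ}
    (ha : 0 ≤ a) (hb : 0 ≤ b) (hc : 0 ≤ c) (hd : 0 ≤ d) :
    ((a + b) ^ p + (c + d) ^ p) ^ (1 / p) ≤
      (a ^ p + c ^ p) ^ (1 / p) + (b ^ p + d ^ p) ^ (1 / p) := by
  have h := Real.Lp_add_le_of_nonneg (s := Finset.univ) (f := ![a, c]) (g := ![b, d]) hp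
    (by simp [Fin.forall_fin_two, ha, hc]) (by simp [Fin.forall_fin_two, hb, hd])
  simpa [Fin.sum_univ_two] using h

variable {G : Type*} [Group G]

/-! ### The space `D_p(G)` -/

/-- The functions `f : G → ℂ` with `∑_g |f(g s⁻¹) - f(g)|^p < ∞` for every `s ∈ S`. -/
def dirichletSubmodule (S : Finset G) (p : ℝ) [hp : Fact (1 ≤ p)] : Submodule ℂ (G → ℂ) where
  carrier := {f | ∀ s ∈ S, Summable fun g => ‖f (g * s⁻¹) - f g‖ ^ p}
  zero_mem' := fun s _ => by
    have : p ≠ 0 := by linarith [hp.out]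
    simp [Real.zero_rpow this]
  add_mem' := fun {f h} hf hh s hs =>
    summable_norm_rpow_of_le hp.out (fun _ => norm_nonneg _) (fun _ => norm_nonneg _)
      (hf s hs) (hh s hs) (fun g => by
        refine le_trans (le_of_eq ?_) (norm_add_le _ _)
        simp only [Pi.add_apply]
        congr 1
        ring)
  smul_mem' := fun c f hf s hs => by
    have := summable_const_mul_rpow (norm_nonneg c) (fun _ => norm_nonneg _) (hf s hs)
    simpa only [Pi.smul_apply, ← smul_sub, norm_smul] using this

/-- The space `D_p(G)`. It is a type of its own, so that it carries the topology of the norm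
below and not the topology of pointwise convergence. -/
def Dp (S : Finset G) (p : ℝ) [Fact (1 ≤ p)] : Type _ := dirichletSubmodule S p

namespace Dp

variable {S : Finset G} {p : ℝ} [hp : Fact (1 ≤ p)]

instance : AddCommGroup (Dp S p) := inferInstanceAs (AddCommGroup (dirichletSubmodule S p))

instance : Module ℂ (Dp S p) := inferInstanceAs (Module ℂ (dirichletSubmodule S p))

/-- The inclusion of `D_p(G)` in the space of all complex-valued functions on `G`. -/
def toFun : Dp S p →ₗ[ℂ] (G → ℂ) := (dirichletSubmodule S p).subtype

instance : CoeFun (Dp S p) (fun _ => G → ℂ) := ⟨fun f => toFun f⟩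

theorem summable (f : Dp S p) {s : G} (hs : s ∈ S) :
    Summable fun g => ‖f (g * s⁻¹) - f g‖ ^ p := f.2 s hs

/-- The pseudonorm `‖f‖ = (∑_{s ∈ S} ∑_g |f(g s⁻¹) - f(g)|^p)^{1/p}`. -/
def energy (f : Dp S p) : ℝ :=
  (∑ s ∈ S, ∑' g : G, ‖f (g * s⁻¹) - f g‖ ^ p) ^ (1 / p)

/-- The norm `‖f‖_{D_p} = (‖f‖^p + |f(e)|^p)^{1/p}`. -/
instance : Norm (Dp S p) := ⟨fun f => (energy f ^ p + ‖f 1‖ ^ p) ^ (1 / p)⟩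

theorem norm_def (f : Dp S p) : ‖f‖ = (energy f ^ p + ‖f 1‖ ^ p) ^ (1 / p) := rfl

theorem energy_nonneg (f : Dp S p) : 0 ≤ energy f := by
  unfold energy
  have : ∀ s ∈ S, 0 ≤ ∑' g : G, ‖f (g * s⁻¹) - f g‖ ^ p :=
    fun s _ => tsum_nonneg fun g => by positivity
  exact Real.rpow_nonneg (Finset.sum_nonneg this) _

theorem energy_smul (c : ℂ) (f : Dp S p) : energy (c • f) = ‖c‖ * energy f := by
  have hp0 : p ≠ 0 := by linarith [hp.out]
  have h0 : 0 ≤ ∑ s ∈ S, ∑' g : G, ‖f (g * s⁻¹) - f g‖ ^ p :=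
    Finset.sum_nonneg fun s _ => tsum_nonneg fun g => by positivity
  unfold energy
  simp only [map_smul, Pi.smul_apply, ← smul_sub, norm_smul,
    Real.mul_rpow (norm_nonneg _) (norm_nonneg _), tsum_mul_left, ← Finset.mul_sum]
  rw [Real.mul_rpow (by positivity) h0, ← Real.rpow_mul (norm_nonneg _), mul_one_div_cancel hp0,
    Real.rpow_one]

theorem energy_add_le (f h : Dp S p) : energy (f + h) ≤ energy f + energy h := by
  have hp1 := hp.out
  have hp0 : p ≠ 0 := by linarith
  have hpp : 0 ≤ p := by linarith
  have key : ∀ u : Dp S p, ∀ s : G, 0 ≤ ∑' g : G, ‖u (g * s⁻¹) - u g‖ ^ p :=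
    fun u s => tsum_nonneg fun g => by positivity
  have back : ∀ u : Dp S p, ∀ s : G, ((∑' g : G, ‖u (g * s⁻¹) - u g‖ ^ p) ^ (1 / p)) ^ p =
      ∑' g : G, ‖u (g * s⁻¹) - u g‖ ^ p := fun u s => by
    rw [← Real.rpow_mul (key u s), one_div_mul_cancel hp0, Real.rpow_one]
  have step : ∀ s ∈ S, ∑' g : G, ‖(f + h) (g * s⁻¹) - (f + h) g‖ ^ p ≤
      ((∑' g : G, ‖f (g * s⁻¹) - f g‖ ^ p) ^ (1 / p) +
        (∑' g : G, ‖h (g * s⁻¹) - h g‖ ^ p) ^ (1 / p)) ^ p := by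
    intro s hs
    have h1 := Real.Lp_add_le_tsum_of_nonneg' hp1 (fun g => norm_nonneg (f (g * s⁻¹) - f g))
      (fun g => norm_nonneg (h (g * s⁻¹) - h g)) (f.summable hs) (h.summable hs)
    have h2 : ∑' g : G, ‖(f + h) (g * s⁻¹) - (f + h) g‖ ^ p ≤
        ∑' g : G, (‖f (g * s⁻¹) - f g‖ + ‖h (g * s⁻¹) - h g‖) ^ p := by
      refine Summable.tsum_le_tsum (fun g => ?_) ((f + h).summable hs)
        (summable_rpow_add hp1 (fun g => norm_nonneg _) (fun g => norm_nonneg _)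
          (f.summable hs) (h.summable hs))
      refine Real.rpow_le_rpow (norm_nonneg _) ?_ hpp
      refine le_trans (le_of_eq ?_) (norm_add_le _ _)
      simp only [map_add, Pi.add_apply]
      congr 1
      ring
    refine h2.trans ?_
    have h3 : 0 ≤ ∑' g : G, (‖f (g * s⁻¹) - f g‖ + ‖h (g * s⁻¹) - h g‖) ^ p :=
      tsum_nonneg fun g => by positivity
    have h4 := Real.rpow_le_rpow (Real.rpow_nonneg h3 _) h1 hpp
    rwa [← Real.rpow_mul h3, one_div_mul_cancel hp0, Real.rpow_one] at h4
  have h5 := Real.Lp_add_le_of_nonneg (s := S)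
    (f := fun s => (∑' g : G, ‖f (g * s⁻¹) - f g‖ ^ p) ^ (1 / p))
    (g := fun s => (∑' g : G, ‖h (g * s⁻¹) - h g‖ ^ p) ^ (1 / p)) hp1
    (fun s _ => Real.rpow_nonneg (key f s) _) (fun s _ => Real.rpow_nonneg (key h s) _)
  simp only [back] at h5
  exact (Real.rpow_le_rpow (Finset.sum_nonneg fun s _ => key (f + h) s)
    (Finset.sum_le_sum step) (by positivity)).trans h5

theorem core : SeminormedSpace.Core ℂ (Dp S p) where
  norm_nonneg f := by
    have := energy_nonneg f
    rw [norm_def]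
    positivity
  norm_smul c f := by
    have hp0 : p ≠ 0 := by linarith [hp.out]
    have := energy_nonneg f
    rw [norm_def, norm_def, energy_smul, map_smul, Pi.smul_apply, norm_smul,
      Real.mul_rpow (norm_nonneg _) this, Real.mul_rpow (norm_nonneg _) (norm_nonneg _),
      ← mul_add, Real.mul_rpow (by positivity) (by positivity), ← Real.rpow_mul (norm_nonneg _),
      mul_one_div_cancel hp0, Real.rpow_one]
  norm_triangle f h := by
    have hp1 := hp.out
    have hpp : 0 ≤ p := by linarith
    have e1 := energy_nonneg f
    have e2 := energy_nonneg h
    have e3 := energy_nonneg (f + h)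
    rw [norm_def, norm_def, norm_def]
    refine le_trans ?_ (rpow_add_rpow_le hp1 e1 e2 (norm_nonneg (f 1)) (norm_nonneg (h 1)))
    refine Real.rpow_le_rpow (by positivity) (add_le_add ?_ ?_) (by positivity)
    · exact Real.rpow_le_rpow e3 (energy_add_le f h) hpp
    · rw [map_add, Pi.add_apply]
      exact Real.rpow_le_rpow (norm_nonneg _) (norm_add_le _ _) hpp

instance : SeminormedAddCommGroup (Dp S p) := SeminormedAddCommGroup.ofCore core

instance : NormedSpace ℂ (Dp S p) where
  norm_smul_le c f := (core.norm_smul c f).le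

end Dp

/-! ### The first reduced `ℓ^p`-cohomology -/

section Cohomology

variable (S : Finset G) (p : ℝ) [hp : Fact (1 ≤ p)]

/-- `ℓ^p(G)` as a subspace of `D_p(G)`. -/
def ellp : Submodule ℂ (Dp S p) where
  carrier := {f | Summable fun g => ‖f g‖ ^ p}
  zero_mem' := by
    have : p ≠ 0 := by linarith [hp.out]
    simp [Real.zero_rpow this]
  add_mem' := fun {f h} hf hh =>
    summable_norm_rpow_of_le hp.out (fun _ => norm_nonneg _) (fun _ => norm_nonneg _) hf hh
      (fun g => by simpa only [map_add, Pi.add_apply] using norm_add_le (f g) (h g))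
  smul_mem' := fun c f hf => by
    have := summable_const_mul_rpow (norm_nonneg c) (fun _ => norm_nonneg _) hf
    simpa only [Set.mem_ofPred_eq, map_smul, Pi.smul_apply, norm_smul] using this

/-- The constant functions as a subspace of `D_p(G)`. -/
def constants : Submodule ℂ (Dp S p) where
  carrier := {f | ∃ c : ℂ, ∀ g, f g = c}
  zero_mem' := ⟨0, fun g => by simp⟩
  add_mem' := fun ⟨c, hc⟩ ⟨d, hd⟩ => ⟨c + d, fun g => by simp [hc, hd]⟩
  smul_mem' := fun a _ ⟨c, hc⟩ => ⟨a * c, fun g => by simp [hc]⟩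

/-- The first reduced `ℓ^p`-cohomology space: the quotient of `D_p(G)` by the closure of
`ℓ^p(G) ⊕ ℂ` in `D_p(G)`. -/
abbrev ReducedCohomology : Type _ :=
  Dp S p ⧸ (ellp S p ⊔ constants S p).topologicalClosure

end Cohomology

/-! ### The algebra `BD_p(G)` and the `p`-harmonic boundary -/

section Boundary

variable (S : Finset G) (p : ℝ) [hp : Fact (1 ≤ p)]

/-- The algebra `BD_p(G)` of bounded functions in `D_p(G)`, with pointwise operations. -/
def BDp : Subalgebra ℂ (G → ℂ) where
  carrier := {f | f ∈ dirichletSubmodule S p ∧ ∃ C : ℝ, ∀ g, ‖f g‖ ≤ C}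
  add_mem' := fun {f h} ⟨hf, C, hC⟩ ⟨hh, D, hD⟩ =>
    ⟨add_mem hf hh, C + D, fun g => (norm_add_le _ _).trans (add_le_add (hC g) (hD g))⟩
  mul_mem' := fun {f h} ⟨hf, C, hC⟩ ⟨hh, D, hD⟩ => by
    have hC0 : 0 ≤ C := (norm_nonneg _).trans (hC 1)
    have hD0 : 0 ≤ D := (norm_nonneg _).trans (hD 1)
    refine ⟨fun s hs => ?_, C * D, fun g => ?_⟩
    · refine summable_norm_rpow_of_le hp.out
        (u := fun g => C * ‖h (g * s⁻¹) - h g‖) (v := fun g => D * ‖f (g * s⁻¹) - f g‖)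
        (fun _ => by positivity) (fun _ => by positivity)
        (summable_const_mul_rpow hC0 (fun _ => norm_nonneg _) (hh s hs))
        (summable_const_mul_rpow hD0 (fun _ => norm_nonneg _) (hf s hs)) (fun g => ?_)
      have e : (f * h) (g * s⁻¹) - (f * h) g =
          f (g * s⁻¹) * (h (g * s⁻¹) - h g) + h g * (f (g * s⁻¹) - f g) := by
        simp only [Pi.mul_apply]
        ring
      rw [e]
      refine (norm_add_le _ _).trans ?_
      rw [norm_mul, norm_mul]
      gcongr
      · exact hC _
      · exact hD _
    · rw [Pi.mul_apply, norm_mul]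
      exact mul_le_mul (hC g) (hD g) (norm_nonneg _) hC0
  algebraMap_mem' := fun c => by
    have : p ≠ 0 := by linarith [hp.out]
    refine ⟨fun s _ => ?_, ‖c‖, fun g => by simp⟩
    simp [Real.zero_rpow this]

variable {S p} in
/-- The inclusion of `BD_p(G)` in `D_p(G)`. -/
def BDp.toDp (f : BDp S p) : Dp S p := ⟨f.1, f.2.1⟩

/-- The characters of `BD_p(G)`: the nonzero algebra homomorphisms `BD_p(G) → ℂ`. -/
abbrev Spectrum : Type _ := {x : BDp S p →ₙₐ[ℂ] ℂ // x ≠ 0}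

/-- The map `i : G → Sp(BD_p(G))`, where `i(g)` is the evaluation at `g`. -/
def evalChar (g : G) : Spectrum S p :=
  ⟨{ toFun := fun f => (f : G → ℂ) g
     map_smul' := fun _ _ => rfl
     map_zero' := rfl
     map_add' := fun _ _ => rfl
     map_mul' := fun _ _ => rfl },
   fun h => one_ne_zero (α := ℂ) (DFunLike.congr_fun h (1 : BDp S p))⟩

/-- The set `ℂG` of functions with finite support, in `D_p(G)`. -/
def finSupp : Set (Dp S p) := {f | (Function.support f).Finite}

/-- The bounded functions in the closure of `ℂG` in `D_p(G)`. -/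
def boundedClosure : Set (BDp S p) := {f | BDp.toDp f ∈ closure (finSupp S p)}

/-- The `p`-harmonic boundary `∂_p(G)`: the characters of `BD_p(G)` that are not evaluations at
elements of `G` and vanish on the bounded functions in the closure of `ℂG`. -/
def harmonicBoundary : Set (Spectrum S p) :=
  {x | x ∉ Set.range (evalChar S p) ∧ ∀ f ∈ boundedClosure S p, x.1 f = 0}

end Boundary

end PHarmonic

end

namespace PHarmonic

open Filter Topology

variable {G : Type*} [Group G] {S : Finset G} {p : ℝ} [hp : Fact (1 ≤ p)]

/-! Let I be the set of bounded functions in the closure of ℂG. It is an ideal of BD_p(G)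
(`mul_mem_boundedClosure`), and the boundary consists of the characters that vanish on I. The core
is a Nullstellensatz (`mem_boundedClosure_of_forall`): a bounded function killed by every boundary
character lies in I.

If the boundary is at most {x}, then f - x(f) lies in I for every bounded f (and f itself does if
the boundary is empty). Hence the closure of ℓ^p(G) ⊕ ℂ contains BD_p(G), which is dense in D_p(G)
by truncation. Conversely, ℓ^p(G) lies in the closure of ℂG, and that closure plus ℂ is closed. So
if ℓ^p(G) ⊕ ℂ is dense, each bounded f is a constant c plus an element of I. Every boundary
character then takes the value c at f, so there is at most one.

For the Nullstellensatz, let A be the set where |f| ≥ r. If some h in I is bounded away from 0 on A,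
the part of f above height r is a multiple of h, hence in I. Otherwise an ultrafilter on A along
which all of I tends to 0 yields a boundary character x with |x(f)| ≥ r. Let r → 0. -/

theorem rpow_le_of_le_add {q : ℝ} (hq : 0 ≤ q) {a b c : ℝ} (ha : 0 ≤ a) (hb : 0 ≤ b)
    (hc : 0 ≤ c) (h : a ≤ b + c) : a ^ q ≤ 2 ^ q * (b ^ q + min a c ^ q) := by
  have hm : 0 ≤ min a c := le_min ha hc
  have h2 : a ≤ 2 * max b (min a c) := by
    rcases min_choice a c with e | e <;> rw [e]
    · linarith [le_max_right b a]
    · linarith [le_max_left b c, le_max_right b c]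
  refine (Real.rpow_le_rpow ha h2 hq).trans ?_
  rw [Real.mul_rpow (by norm_num) (le_max_of_le_left hb)]
  gcongr
  rcases max_choice b (min a c) with e | e <;> rw [e]
  · exact le_add_of_nonneg_right (by positivity)
  · exact le_add_of_nonneg_left (by positivity)

/-! ### Convergence in `D_p(G)` -/

namespace Dp

theorem energy_rpow (f : Dp S p) :
    energy f ^ p = ∑ s ∈ S, ∑' g : G, ‖f (g * s⁻¹) - f g‖ ^ p := by
  have hp0 : p ≠ 0 := by linarith [hp.out]
  have h0 : 0 ≤ ∑ s ∈ S, ∑' g : G, ‖f (g * s⁻¹) - f g‖ ^ p :=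
    Finset.sum_nonneg fun s _ => tsum_nonneg fun g => by positivity
  rw [energy, ← Real.rpow_mul h0, one_div_mul_cancel hp0, Real.rpow_one]

theorem norm_rpow (f : Dp S p) :
    ‖f‖ ^ p = ∑ s ∈ S, ∑' g : G, ‖f (g * s⁻¹) - f g‖ ^ p + ‖f 1‖ ^ p := by
  have hp0 : p ≠ 0 := by linarith [hp.out]
  have h0 : 0 ≤ energy f ^ p + ‖f 1‖ ^ p := by
    have := energy_nonneg f
    positivity
  rw [norm_def, ← Real.rpow_mul h0, one_div_mul_cancel hp0, Real.rpow_one, energy_rpow]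

theorem norm_apply_one_le (f : Dp S p) : ‖f 1‖ ≤ ‖f‖ := by
  have hp0 : 0 < p := by linarith [hp.out]
  refine (Real.rpow_le_rpow_iff (norm_nonneg _) (norm_nonneg _) hp0).1 ?_
  rw [norm_rpow]
  exact le_add_of_nonneg_left
    (Finset.sum_nonneg fun s _ => tsum_nonneg fun g => by positivity)

theorem tsum_le_norm_rpow (f : Dp S p) {s : G} (hs : s ∈ S) :
    ∑' g : G, ‖f (g * s⁻¹) - f g‖ ^ p ≤ ‖f‖ ^ p := by
  rw [norm_rpow]
  have := Finset.single_le_sum (f := fun s => ∑' g : G, ‖f (g * s⁻¹) - f g‖ ^ p)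
    (fun s _ => tsum_nonneg fun g => by positivity) hs
  exact this.trans (le_add_of_nonneg_right (by positivity))

theorem norm_sub_le (f : Dp S p) {s : G} (hs : s ∈ S) (g : G) :
    ‖f (g * s⁻¹) - f g‖ ≤ ‖f‖ := by
  have hp0 : 0 < p := by linarith [hp.out]
  refine (Real.rpow_le_rpow_iff (norm_nonneg _) (norm_nonneg _) hp0).1 ?_
  exact ((f.summable hs).le_tsum g fun _ _ => by positivity).trans (f.tsum_le_norm_rpow hs)

/-- Evaluation at a point is bounded on `D_p(G)`. -/
theorem exists_norm_apply_le (hgen : Subgroup.closure (S : Set G) = ⊤) (g : G) :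
    ∃ C : ℝ, ∀ f : Dp S p, ‖f g‖ ≤ C * ‖f‖ := by
  have hg : g ∈ Subgroup.closure (S : Set G) := by simp [hgen]
  -- Along a word in the generators, each letter changes the value by at most `‖f‖`.
  induction hg using Subgroup.closure_induction_right with
  | one => exact ⟨1, fun f => by simpa using f.norm_apply_one_le⟩
  | mul_right x _ s hs ih =>
    obtain ⟨C, hC⟩ := ih
    refine ⟨C + 1, fun f => ?_⟩
    have h1 := f.norm_sub_le hs (x * s)
    rw [mul_inv_cancel_right] at h1
    have h2 := norm_sub_norm_le (f (x * s)) (f x)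
    rw [norm_sub_rev] at h2
    linarith [hC f]
  | mul_inv_cancel x _ s hs ih =>
    obtain ⟨C, hC⟩ := ih
    refine ⟨C + 1, fun f => ?_⟩
    have h1 := f.norm_sub_le hs x
    have h2 := norm_sub_norm_le (f (x * s⁻¹)) (f x)
    linarith [hC f]

theorem tendsto_apply_zero (hgen : Subgroup.closure (S : Set G) = ⊤) {ι : Type*} {l : Filter ι}
    {v : ι → Dp S p} (hv : Tendsto v l (𝓝 0)) (g : G) :
    Tendsto (fun i => v i g) l (𝓝 0) := by
  obtain ⟨C, hC⟩ := exists_norm_apply_le (p := p) hgen g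
  refine squeeze_zero_norm (fun i => hC (v i)) ?_
  simpa using (tendsto_zero_iff_norm_tendsto_zero.1 hv).const_mul C

theorem tendsto_zero_of_tsum {ι : Type*} {l : Filter ι} {w : ι → Dp S p}
    (h1 : Tendsto (fun i => w i 1) l (𝓝 0))
    (hs : ∀ s ∈ S, Tendsto (fun i => ∑' g : G, ‖w i (g * s⁻¹) - w i g‖ ^ p) l (𝓝 0)) :
    Tendsto w l (𝓝 0) := by
  have hp0 : 0 < p := by linarith [hp.out]
  have h := (tendsto_finsetSum S hs).add
    ((tendsto_zero_iff_norm_tendsto_zero.1 h1).rpow_const (p := p) (Or.inr hp0.le))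
  simp only [← norm_rpow, Finset.sum_const_zero, Real.zero_rpow hp0.ne', add_zero] at h
  have h' := h.rpow_const (p := 1 / p) (Or.inr (by positivity))
  rw [Real.zero_rpow (by positivity)] at h'
  refine tendsto_zero_iff_norm_tendsto_zero.2 (h'.congr fun i => ?_)
  rw [← Real.rpow_mul (norm_nonneg _), mul_one_div_cancel hp0.ne', Real.rpow_one]

/-- Dominated convergence in `D_p(G)`. -/
theorem tendsto_zero_of_dominated {ι : Type*} {l : Filter ι} {w v : ι → Dp S p}
    {c : G → G → ℝ} {C : ℝ} (hC : 0 ≤ C) (hc0 : ∀ s g, 0 ≤ c s g)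
    (hc : ∀ s ∈ S, Summable fun g => c s g ^ p) (hv : Tendsto v l (𝓝 0))
    (hw : ∀ g, Tendsto (fun i => w i g) l (𝓝 0))
    (hle : ∀ i, ∀ s ∈ S, ∀ g,
      ‖w i (g * s⁻¹) - w i g‖ ≤ C * ‖v i (g * s⁻¹) - v i g‖ + c s g) :
    Tendsto w l (𝓝 0) := by
  have hp0 : 0 < p := by linarith [hp.out]
  refine tendsto_zero_of_tsum (hw 1) fun s hs => ?_
  set a : ι → G → ℝ := fun i g => ‖w i (g * s⁻¹) - w i g‖ with ha
  have ha0 : ∀ i g, 0 ≤ a i g := fun i g => norm_nonneg _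
  have hm0 : ∀ i g, 0 ≤ min (a i g) (c s g) := fun i g => le_min (ha0 i g) (hc0 s g)
  have hmle : ∀ i g, min (a i g) (c s g) ^ p ≤ c s g ^ p := fun i g =>
    Real.rpow_le_rpow (hm0 i g) (min_le_right _ _) hp0.le
  have hms : ∀ i, Summable fun g => min (a i g) (c s g) ^ p := fun i =>
    Summable.of_nonneg_of_le (fun g => Real.rpow_nonneg (hm0 i g) _) (hmle i) (hc s hs)
  -- The bound `c` does not depend on `i`, but its minimum with `a i` tends to 0 pointwise and stays
  -- dominated by `c`. What remains of `a i` is controlled by `v i`, which tends to 0 in norm.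
  have hmt : Tendsto (fun i => ∑' g, min (a i g) (c s g) ^ p) l (𝓝 0) := by
    have := tendsto_tsum_of_dominated_convergence (𝓕 := l)
      (f := fun i g => min (a i g) (c s g) ^ p) (g := fun _ => (0 : ℝ)) (hc s hs) (fun g => ?_)
      (Eventually.of_forall fun i g => ?_)
    · simpa using this
    · have h1 : Tendsto (fun i => a i g) l (𝓝 0) := by
        simpa using ((hw (g * s⁻¹)).sub (hw g)).norm
      have h2 := h1.rpow_const (p := p) (Or.inr hp0.le)
      rw [Real.zero_rpow hp0.ne'] at h2
      exact squeeze_zero (fun i => Real.rpow_nonneg (hm0 i g) _)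
        (fun i => Real.rpow_le_rpow (hm0 i g) (min_le_left _ _) hp0.le) h2
    · rw [Real.norm_of_nonneg (Real.rpow_nonneg (hm0 i g) _)]
      exact hmle i g
  have hvn := ((tendsto_zero_iff_norm_tendsto_zero.1 hv).rpow_const (p := p)
    (Or.inr hp0.le)).const_mul (C ^ p)
  rw [Real.zero_rpow hp0.ne', mul_zero] at hvn
  have hlim := (hvn.add hmt).const_mul (2 ^ p)
  rw [add_zero, mul_zero] at hlim
  refine squeeze_zero (fun i => tsum_nonneg fun g => by positivity) (fun i => ?_) hlim
  have hvs := ((v i).summable hs).mul_left (C ^ p)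
  have key : ∑' g, a i g ^ p ≤
      ∑' g, 2 ^ p * (C ^ p * ‖v i (g * s⁻¹) - v i g‖ ^ p + min (a i g) (c s g) ^ p) := by
    refine Summable.tsum_le_tsum (fun g => ?_) ((w i).summable hs)
      ((hvs.add (hms i)).mul_left _)
    rw [← Real.mul_rpow hC (norm_nonneg _)]
    exact rpow_le_of_le_add hp0.le (ha0 i g) (by positivity) (hc0 s g) (hle i s hs g)
  refine key.trans ?_
  rw [tsum_mul_left, hvs.tsum_add (hms i), tsum_mul_left]
  have := (v i).tsum_le_norm_rpow hs
  gcongr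

end Dp

/-! ### Lipschitz operations and truncation -/

theorem dirichlet_comp {T : ℂ → ℂ} {K : ℝ} (hK : 0 ≤ K)
    (hT : ∀ z w, ‖T z - T w‖ ≤ K * ‖z - w‖) {f : G → ℂ} (hf : f ∈ dirichletSubmodule S p) :
    T ∘ f ∈ dirichletSubmodule S p := fun s hs =>
  Summable.of_nonneg_of_le (fun _ => by positivity)
    (fun g => Real.rpow_le_rpow (norm_nonneg _) (hT _ _) (by linarith [hp.out]))
    (summable_const_mul_rpow hK (fun _ => norm_nonneg _) (hf s hs))

theorem BDp_comp {T : ℂ → ℂ} {K : ℝ} (hK : 0 ≤ K)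
    (hT : ∀ z w, ‖T z - T w‖ ≤ K * ‖z - w‖) {f : G → ℂ} (hf : f ∈ BDp S p) :
    T ∘ f ∈ BDp S p := by
  obtain ⟨hf, C, hC⟩ := hf
  refine ⟨dirichlet_comp hK hT hf, K * C + ‖T 0‖, fun g => ?_⟩
  have h1 := hT (f g) 0
  rw [sub_zero] at h1
  have h2 := norm_sub_norm_le (T (f g)) (T 0)
  have h3 := mul_le_mul_of_nonneg_left (hC g) hK
  simp only [Function.comp_apply]
  linarith

/-- Truncation of the real and imaginary parts to `[-r, r]`. -/
def clamp (r : ℝ) (z : ℂ) : ℂ := ⟨max (min z.re r) (-r), max (min z.im r) (-r)⟩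

/-- The real and imaginary parts are each truncated by a 1-Lipschitz map; adding the two estimates
gives the factor 2. -/
theorem norm_clamp_sub_le (r : ℝ) (z w : ℂ) : ‖clamp r z - clamp r w‖ ≤ 2 * ‖z - w‖ := by
  have key : ∀ a b : ℝ, |max (min a r) (-r) - max (min b r) (-r)| ≤ |a - b| := fun a b =>
    (abs_max_sub_max_le_abs _ _ _).trans (abs_min_sub_min_le_max _ _ _ _ |>.trans (by simp))
  have h1 := Complex.norm_le_abs_re_add_abs_im (clamp r z - clamp r w)
  have h2 := key z.re w.re
  have h3 := key z.im w.im
  have h4 := Complex.abs_re_le_norm (z - w)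
  have h5 := Complex.abs_im_le_norm (z - w)
  simp only [Complex.sub_re, Complex.sub_im, clamp] at h1 h4 h5 ⊢
  linarith

theorem norm_clamp_le {r : ℝ} (hr : 0 ≤ r) (z : ℂ) : ‖clamp r z‖ ≤ 2 * r := by
  have key : ∀ a : ℝ, |max (min a r) (-r)| ≤ r := fun a =>
    abs_le.2 ⟨le_max_right _ _, max_le (min_le_right _ _) (by linarith)⟩
  have h1 := Complex.norm_le_abs_re_add_abs_im (clamp r z)
  have h2 := key z.re
  have h3 := key z.im
  simp only [clamp] at h1 ⊢
  linarith

theorem clamp_of_norm_le {r : ℝ} {z : ℂ} (hz : ‖z‖ ≤ r) : clamp r z = z := by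
  have h4 := abs_le.1 ((Complex.abs_re_le_norm z).trans hz)
  have h5 := abs_le.1 ((Complex.abs_im_le_norm z).trans hz)
  apply Complex.ext <;> simp only [clamp]
  · rw [min_eq_left h4.2, max_eq_left h4.1]
  · rw [min_eq_left h5.2, max_eq_left h5.1]

theorem clamp_zero {r : ℝ} (hr : 0 ≤ r) : clamp r 0 = 0 := clamp_of_norm_le (by simpa using hr)

/-- Truncation of an element of `D_p(G)`, as a bounded function. -/
def Dp.trunc (f : Dp S p) {r : ℝ} (hr : 0 ≤ r) : BDp S p :=
  ⟨clamp r ∘ f, dirichlet_comp zero_le_two (norm_clamp_sub_le r) f.2, 2 * r,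
    fun _ => norm_clamp_le hr _⟩

theorem Dp.toDp_trunc_apply (f : Dp S p) {r : ℝ} (hr : 0 ≤ r) (g : G) :
    BDp.toDp (f.trunc hr) g = clamp r (f g) := rfl

/-- Truncations at large heights converge to the function. -/
theorem Dp.tendsto_trunc_nat (f : Dp S p) :
    Tendsto (fun n : ℕ => BDp.toDp (f.trunc n.cast_nonneg)) atTop (𝓝 f) := by
  rw [← tendsto_sub_nhds_zero_iff]
  -- With `v = 0` this is plain dominated convergence; 3 is the Lipschitz constant 2 of `clamp` plus
  -- 1 for `f` itself.
  refine tendsto_zero_of_dominated (v := fun _ => 0) (C := 0)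
    (c := fun s g => 3 * ‖f (g * s⁻¹) - f g‖) le_rfl (fun _ _ => by positivity)
    (fun s hs => summable_const_mul_rpow (by norm_num) (fun _ => norm_nonneg _) (f.summable hs))
    tendsto_const_nhds (fun g => ?_) (fun n s _ g => ?_)
  · refine tendsto_const_nhds.congr' ?_
    filter_upwards [tendsto_natCast_atTop_atTop.eventually_ge_atTop ‖f g‖] with n hn
    simp [Dp.toDp_trunc_apply, clamp_of_norm_le hn]
  · have h := norm_clamp_sub_le n (f (g * s⁻¹)) (f g)
    simp only [map_sub, Pi.sub_apply, Dp.toDp_trunc_apply, zero_mul, zero_add]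
    rw [sub_sub_sub_comm]
    exact (_root_.norm_sub_le _ _).trans (by linarith)

/-- Truncations at small heights converge to zero. -/
theorem Dp.tendsto_trunc_zero (f : Dp S p) :
    Tendsto (fun n : ℕ => BDp.toDp (f.trunc (Nat.one_div_pos_of_nat (α := ℝ) (n := n)).le))
      atTop (𝓝 0) := by
  refine tendsto_zero_of_dominated (v := fun _ => 0) (C := 0)
    (c := fun s g => 2 * ‖f (g * s⁻¹) - f g‖) le_rfl (fun _ _ => by positivity)
    (fun s hs => summable_const_mul_rpow (by norm_num) (fun _ => norm_nonneg _) (f.summable hs))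
    tendsto_const_nhds (fun g => ?_) (fun n s _ g => ?_)
  · refine squeeze_zero_norm
      (fun n => norm_clamp_le (Nat.one_div_pos_of_nat (α := ℝ) (n := n)).le (f g)) ?_
    simpa using (tendsto_one_div_add_atTop_nhds_zero_nat (𝕜 := ℝ)).const_mul 2
  · simpa [Dp.toDp_trunc_apply] using norm_clamp_sub_le _ (f (g * s⁻¹)) (f g)

/-! ### The closure of the finitely supported functions -/

theorem dirichlet_of_summable {f : G → ℂ} (hf : Summable fun g => ‖f g‖ ^ p) :
    f ∈ dirichletSubmodule S p := fun s _ =>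
  summable_norm_rpow_of_le hp.out (fun _ => norm_nonneg _) (fun _ => norm_nonneg _)
    (hf.comp_injective (mul_left_injective s⁻¹)) hf fun _ => norm_sub_le _ _

theorem summable_rpow_of_finite_support {α : Type*} {f : α → ℂ} (hf : (Function.support f).Finite) :
    Summable fun g => ‖f g‖ ^ p := by
  have hp0 : p ≠ 0 := by linarith [hp.out]
  refine summable_of_hasFiniteSupport (hf.subset fun g hg => ?_)
  rw [Function.mem_support] at hg ⊢
  contrapose! hg
  simp [hg, Real.zero_rpow hp0]

variable (S p) in
/-- The closure of `ℂG` in `D_p(G)`, as a subspace. -/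
noncomputable def closureFinSupp : Submodule ℂ (Dp S p) :=
  Submodule.topologicalClosure
    { carrier := finSupp S p
      zero_mem' := by simp [finSupp]
      add_mem' := fun {f h} hf hh => by
        refine (Set.Finite.union hf hh).subset ?_
        rw [map_add]
        exact Function.support_add (f : G → ℂ) h
      smul_mem' := fun c f hf => by
        refine Set.Finite.subset hf ?_
        rw [map_smul]
        exact Function.support_const_smul_subset c (f : G → ℂ) }

theorem isClosed_closureFinSupp : IsClosed (closureFinSupp S p : Set (Dp S p)) :=
  Submodule.isClosed_topologicalClosure _

theorem mem_closureFinSupp {f : Dp S p} : f ∈ closureFinSupp S p ↔ f ∈ closure (finSupp S p) :=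
  Iff.rfl

theorem finSupp_subset_ellp {f : Dp S p} (hf : f ∈ finSupp S p) : f ∈ ellp S p :=
  summable_rpow_of_finite_support hf

theorem ellp_le_closureFinSupp : ellp S p ≤ closureFinSupp S p := by
  classical
  intro f hf
  have hf' : Summable fun g => ‖f g‖ ^ p := hf
  have hfin : ∀ F : Finset G, (Function.support ((F : Set G).indicator f)).Finite := fun F =>
    F.finite_toSet.subset Set.support_indicator_subset
  let u : Finset G → Dp S p := fun F =>
    ⟨(F : Set G).indicator f, dirichlet_of_summable (summable_rpow_of_finite_support (hfin F))⟩
  have hu : ∀ F g, u F g = (F : Set G).indicator f g := fun _ _ => rfl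
  have hnorm : ∀ F g, ‖(u F - f) g‖ ≤ ‖f g‖ := by
    intro F g
    rw [map_sub, Pi.sub_apply, hu, Set.indicator_apply]
    split_ifs <;> simp
  refine mem_closureFinSupp.2 (mem_closure_of_tendsto (f := u) (b := atTop) ?_
    (Eventually.of_forall fun F => hfin F))
  rw [← tendsto_sub_nhds_zero_iff]
  refine Dp.tendsto_zero_of_dominated (v := fun _ => 0) (C := 0)
    (c := fun s g => ‖f (g * s⁻¹)‖ + ‖f g‖) le_rfl (fun _ _ => by positivity)
    (fun s hs => summable_rpow_add hp.out (fun _ => norm_nonneg _) (fun _ => norm_nonneg _)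
      (hf'.comp_injective (mul_left_injective s⁻¹)) hf')
    tendsto_const_nhds (fun g => ?_) (fun F s _ g => ?_)
  · refine tendsto_const_nhds.congr' ?_
    filter_upwards [eventually_ge_atTop {g}] with F hF
    have : g ∈ (F : Set G) := hF (Finset.mem_singleton_self g)
    rw [map_sub, Pi.sub_apply, hu, Set.indicator_of_mem this, sub_self]
  · rw [zero_mul, zero_add]
    exact (norm_sub_le _ _).trans (add_le_add (hnorm _ _) (hnorm _ _))

/-- The bounded functions in the closure of `ℂG` form an ideal of `BD_p(G)`. -/
theorem mul_mem_boundedClosure (hgen : Subgroup.closure (S : Set G) = ⊤) (f : BDp S p)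
    {u : BDp S p} (hu : u ∈ boundedClosure S p) : f * u ∈ boundedClosure S p := by
  obtain ⟨F, hF⟩ := f.2.2
  obtain ⟨M, hM⟩ := u.2.2
  have hF0 : 0 ≤ F := (norm_nonneg _).trans (hF 1)
  have hM0 : 0 ≤ M := (norm_nonneg _).trans (hM 1)
  obtain ⟨v, hv, hvu⟩ := mem_closure_iff_seq_limit.1 hu
  rw [← tendsto_sub_nhds_zero_iff] at hvu
  have hfu : ∀ n g, BDp.toDp (f * (v n).trunc hM0) g = f.1 g * clamp M (v n g) := fun _ _ => rfl
  have hfu' : ∀ g, BDp.toDp (f * u) g = f.1 g * clamp M (u.1 g) := fun g => by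
    rw [clamp_of_norm_le (hM g)]
    rfl
  -- The approximants `v n` of `u` need not be uniformly bounded, so they are truncated at a bound
  -- `M` of `u`. This keeps finite support and leaves `u` unchanged.
  refine mem_closure_of_tendsto (f := fun n => BDp.toDp (f * (v n).trunc hM0)) (b := atTop) ?_
    (Eventually.of_forall fun n => ?_)
  · rw [← tendsto_sub_nhds_zero_iff]
    refine Dp.tendsto_zero_of_dominated (C := F * 2)
      (c := fun s g => F * 4 * ‖u.1 (g * s⁻¹) - u.1 g‖ + 4 * M * ‖f.1 (g * s⁻¹) - f.1 g‖)
      (by positivity) (fun _ _ => by positivity)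
      (fun s hs => summable_rpow_add hp.out (fun _ => by positivity) (fun _ => by positivity)
        (summable_const_mul_rpow (by positivity) (fun _ => norm_nonneg _) (u.2.1 s hs))
        (summable_const_mul_rpow (by positivity) (fun _ => norm_nonneg _) (f.2.1 s hs)))
      hvu (fun g => ?_) (fun n s _ g => ?_)
    · have h1 := (Dp.tendsto_apply_zero hgen hvu g).norm
      rw [norm_zero] at h1
      refine squeeze_zero_norm (fun n => ?_) (by simpa using h1.const_mul (F * 2))
      rw [map_sub, Pi.sub_apply, hfu, hfu', ← mul_sub, norm_mul, mul_assoc]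
      exact mul_le_mul (hF g) (norm_clamp_sub_le M _ _) (norm_nonneg _) hF0
    · simp only [map_sub, Pi.sub_apply, hfu, hfu']
      have hd : ∀ g, BDp.toDp u g = u.1 g := fun _ => rfl
      simp only [hd]
      set a := v n (g * s⁻¹)
      set b := v n g
      set x := u.1 (g * s⁻¹)
      set y := u.1 g
      set k := f.1 (g * s⁻¹)
      set m := f.1 g with hm
      -- Since `clamp` is not linear, the differences of `clamp M a` and of `clamp M x` are
      -- estimated separately. The first brings in `‖a - b‖`, which `h4` splits into a part tending
      -- to 0 in norm and a fixed p-summable part; hence `F * 4` in the dominating function.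
      have e : k * clamp M a - k * clamp M x - (m * clamp M b - m * clamp M y) =
          m * (clamp M a - clamp M b) - m * (clamp M x - clamp M y) +
          (k - m) * (clamp M a - clamp M x) := by ring
      have h1 : ‖m * (clamp M a - clamp M b)‖ ≤ F * (2 * ‖a - b‖) := by
        rw [norm_mul]
        exact mul_le_mul (hF g) (norm_clamp_sub_le M _ _) (norm_nonneg _) hF0
      have h2 : ‖m * (clamp M x - clamp M y)‖ ≤ F * (2 * ‖x - y‖) := by
        rw [norm_mul]
        exact mul_le_mul (hF g) (norm_clamp_sub_le M _ _) (norm_nonneg _) hF0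
      have h3 : ‖(k - m) * (clamp M a - clamp M x)‖ ≤ ‖k - m‖ * (4 * M) := by
        rw [norm_mul]
        gcongr
        refine (norm_sub_le _ _).trans ?_
        linarith [norm_clamp_le hM0 a, norm_clamp_le hM0 x]
      have h4 : ‖a - b‖ ≤ ‖a - x - (b - y)‖ + ‖x - y‖ := by
        refine le_trans (le_of_eq ?_) (norm_add_le _ _)
        congr 1
        ring
      have h5 := mul_le_mul_of_nonneg_left h4 hF0
      rw [e]
      refine (norm_add_le _ _).trans ((add_le_add (norm_sub_le _ _) le_rfl).trans ?_)
      linarith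
  · refine Set.Finite.subset (hv n) fun g hg => ?_
    rw [Function.mem_support, hfu] at hg
    rw [Function.mem_support]
    contrapose! hg
    rw [hg, clamp_zero hM0, mul_zero]

theorem add_mem_boundedClosure {f h : BDp S p} (hf : f ∈ boundedClosure S p)
    (hh : h ∈ boundedClosure S p) : f + h ∈ boundedClosure S p :=
  (closureFinSupp S p).add_mem (mem_closureFinSupp.2 hf) (mem_closureFinSupp.2 hh)

theorem zero_mem_boundedClosure : (0 : BDp S p) ∈ boundedClosure S p :=
  (closureFinSupp S p).zero_mem

variable (S p) in
/-- The indicator function of a point, in `BD_p(G)`. -/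
def pointMass [DecidableEq G] (g : G) : BDp S p :=
  ⟨Pi.single g 1, dirichlet_of_summable (summable_rpow_of_finite_support
    ((Set.finite_singleton g).subset Pi.support_single_subset)), 1, fun h => by
      by_cases e : h = g
      · subst e; simp
      · simp [Pi.single_eq_of_ne e]⟩

theorem pointMass_mem_boundedClosure [DecidableEq G] (g : G) :
    pointMass S p g ∈ boundedClosure S p :=
  subset_closure ((Set.finite_singleton g).subset Pi.support_single_subset)

/-- The complex conjugate of a function in `BD_p(G)`. -/
def BDp.conj (f : BDp S p) : BDp S p :=
  ⟨starRingEnd ℂ ∘ f.1, BDp_comp (K := 1) zero_le_one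
    (fun z w => by rw [← map_sub, RCLike.norm_conj, one_mul]) f.2⟩

/-! ### Characters -/

theorem Spectrum.map_one (x : Spectrum S p) : x.1 1 = 1 := by
  have h : x.1 1 * x.1 1 = x.1 1 := by rw [← map_mul, mul_one]
  rcases mul_left_eq_self₀.1 h with h | h
  · exact h
  · exact absurd (NonUnitalAlgHom.ext fun f => by
      rw [← one_mul f, map_mul, h, zero_mul]; rfl) x.2

/-- Evaluation at `g` is excluded automatically: it is 1 on the point mass at `g`, which has finite
support. -/
theorem mem_harmonicBoundary_iff {x : Spectrum S p} :
    x ∈ harmonicBoundary S p ↔ ∀ f ∈ boundedClosure S p, x.1 f = 0 := by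
  classical
  refine ⟨fun h => h.2, fun h => ⟨?_, h⟩⟩
  rintro ⟨g, rfl⟩
  have := h _ (pointMass_mem_boundedClosure g)
  simp [evalChar, pointMass] at this

/-- Every ultrafilter on `G` gives a character by taking limits. -/
theorem exists_char_of_ultrafilter (U : Ultrafilter G) :
    ∃ x : Spectrum S p, ∀ f : BDp S p, Tendsto f.1 U (𝓝 (x.1 f)) := by
  have hlim : ∀ f : BDp S p, ∃ z : ℂ, Tendsto f.1 U (𝓝 z) := fun f => by
    obtain ⟨C, hC⟩ := f.2.2
    obtain ⟨z, -, hz⟩ := (isCompact_closedBall (0 : ℂ) C).ultrafilter_le_nhds' (U.map f.1)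
      (Ultrafilter.mem_map.2 (Filter.univ_mem' fun g => by simpa using hC g))
    exact ⟨z, hz⟩
  choose x hx using hlim
  refine ⟨⟨{ toFun := x
             map_smul' := fun c f => tendsto_nhds_unique (hx _) ((hx f).const_smul c)
             map_zero' := tendsto_nhds_unique (hx _) tendsto_const_nhds
             map_add' := fun f h => tendsto_nhds_unique (hx _) ((hx f).add (hx h))
             map_mul' := fun f h => tendsto_nhds_unique (hx _) ((hx f).mul (hx h)) },
    fun h => ?_⟩, hx⟩
  have h1 : x 1 = 0 := DFunLike.congr_fun h (1 : BDp S p)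
  have h2 : x 1 = 1 := tendsto_nhds_unique (hx 1) tendsto_const_nhds
  exact zero_ne_one (h1.symm.trans h2)

/-! ### Boundary characters determine the ideal -/

/-- If no function of the ideal is bounded away from zero on `A`, then some ultrafilter containing
`A` makes all functions of the ideal tend to zero. -/
theorem exists_ultrafilter (hgen : Subgroup.closure (S : Set G) = ⊤) {A : Set G}
    (hA : ∀ h ∈ boundedClosure S p, ∀ δ > 0, ∃ g ∈ A, ‖h.1 g‖ < δ) :
    ∃ U : Ultrafilter G, A ∈ U ∧ ∀ h ∈ boundedClosure S p, Tendsto h.1 U (𝓝 0) := by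
  let F : boundedClosure S p → Filter G := fun h =>
    comap (fun g => ‖h.1.1 g‖) (𝓝 0) ⊓ 𝓟 A
  have hne : ∀ h, NeBot (F h) := by
    intro h
    refine ((Metric.nhds_basis_ball.comap _).inf_principal A).neBot_iff.2 fun {δ} hδ => ?_
    obtain ⟨g, hgA, hg⟩ := hA h.1 h.2 δ hδ
    exact ⟨g, by simpa using hg, hgA⟩
  have hdir : Directed (· ≥ ·) F := by
    intro h k
    -- |h|² + |k|² is again in the ideal and is small only where both h and k are.
    let m : BDp S p := BDp.conj h.1 * h.1 + BDp.conj k.1 * k.1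
    have hm : m ∈ boundedClosure S p := add_mem_boundedClosure
      (mul_mem_boundedClosure hgen _ h.2) (mul_mem_boundedClosure hgen _ k.2)
    have hmn : ∀ g, ‖m.1 g‖ = ‖h.1.1 g‖ ^ 2 + ‖k.1.1 g‖ ^ 2 := fun g => by
      have : m.1 g = ((‖h.1.1 g‖ ^ 2 + ‖k.1.1 g‖ ^ 2 : ℝ) : ℂ) := by
        push_cast
        rw [← Complex.conj_mul', ← Complex.conj_mul']
        rfl
      rw [this, Complex.norm_real, Real.norm_of_nonneg (by positivity)]
    have aux : ∀ w : G → ℂ, (∀ g, ‖w g‖ ^ 2 ≤ ‖m.1 g‖) →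
        comap (fun g => ‖m.1 g‖) (𝓝 0) ≤ comap (fun g => ‖w g‖) (𝓝 0) := by
      intro w hw
      refine tendsto_iff_comap.1 ?_
      have h1 : Tendsto (fun g => √‖m.1 g‖) (comap (fun g => ‖m.1 g‖) (𝓝 0)) (𝓝 0) := by
        simpa using (tendsto_comap (f := fun g => ‖m.1 g‖) (x := 𝓝 (0 : ℝ))).sqrt
      exact squeeze_zero (fun g => norm_nonneg _) (fun g => Real.le_sqrt_of_sq_le (hw g)) h1
    refine ⟨⟨m, hm⟩, inf_le_inf_right _ (aux _ fun g => ?_), inf_le_inf_right _ (aux _ fun g => ?_)⟩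
    · rw [hmn]
      exact le_add_of_nonneg_right (by positivity)
    · rw [hmn]
      exact le_add_of_nonneg_left (by positivity)
  have hI : NeBot (iInf F) := iInf_neBot_of_directed hdir hne
  refine ⟨Ultrafilter.of (iInf F), ?_, fun h hh => ?_⟩
  · exact Ultrafilter.of_le (iInf F)
      (iInf_le F ⟨0, zero_mem_boundedClosure⟩ (inf_le_right (a := comap _ _) (mem_principal_self A)))
  · refine tendsto_zero_iff_norm_tendsto_zero.2 (tendsto_iff_comap.2 ?_)
    exact (Ultrafilter.of_le (iInf F)).trans ((iInf_le F ⟨h, hh⟩).trans inf_le_left)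

/-- A function killed by all characters in the `p`-harmonic boundary lies in the closure
of `ℂG`. -/
theorem mem_boundedClosure_of_forall (hgen : Subgroup.closure (S : Set G) = ⊤) {f : BDp S p}
    (hf : ∀ x ∈ harmonicBoundary S p, x.1 f = 0) : f ∈ boundedClosure S p := by
  -- The difference vanishes where |f| ≤ r, so only the set |f| ≥ r matters.
  have key : ∀ (r : ℝ) (hr : 0 < r), f - (BDp.toDp f).trunc hr.le ∈ boundedClosure S p := by
    intro r hr
    obtain ⟨h, hh, δ, hδ, hA⟩ : ∃ h ∈ boundedClosure S p, ∃ δ > 0,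
        ∀ g ∈ {g | r ≤ ‖f.1 g‖}, δ ≤ ‖h.1 g‖ := by
      by_contra! hcon
      obtain ⟨U, hU, hUI⟩ := exists_ultrafilter hgen hcon
      obtain ⟨x, hx⟩ := exists_char_of_ultrafilter (S := S) (p := p) U
      have hxf := hf x (mem_harmonicBoundary_iff.2 fun h hh =>
        tendsto_nhds_unique (hx h) (hUI h hh))
      have := ge_of_tendsto (hx f).norm hU
      rw [hxf, norm_zero] at this
      linarith
    -- A Lipschitz substitute for 1/|z| that agrees with it for |z| ≥ δ. Thus `t * t * conj h * h`
    -- equals 1 where |f| ≥ r.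
    let φ : ℂ → ℂ := fun z => (((max ‖z‖ δ)⁻¹ : ℝ) : ℂ)
    have hφ : ∀ z w, ‖φ z - φ w‖ ≤ (δ ^ 2)⁻¹ * ‖z - w‖ := by
      intro z w
      have hz : δ ≤ max ‖z‖ δ := le_max_right _ _
      have hw : δ ≤ max ‖w‖ δ := le_max_right _ _
      have hz0 : 0 < max ‖z‖ δ := by linarith
      have hw0 : 0 < max ‖w‖ δ := by linarith
      simp only [φ]
      rw [← Complex.ofReal_sub, Complex.norm_real, Real.norm_eq_abs,
        inv_sub_inv hz0.ne' hw0.ne', abs_div, abs_of_pos (mul_pos hz0 hw0), div_eq_inv_mul]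
      have h1 : |max ‖w‖ δ - max ‖z‖ δ| ≤ ‖z - w‖ := by
        refine (abs_max_sub_max_le_abs _ _ _).trans ?_
        rw [abs_sub_comm]
        exact abs_norm_sub_norm_le z w
      gcongr
      rw [sq]
      gcongr
    let t : BDp S p := ⟨φ ∘ h.1, BDp_comp (by positivity) hφ h.2⟩
    have e : f - (BDp.toDp f).trunc hr.le =
        (f - (BDp.toDp f).trunc hr.le) * t * t * BDp.conj h * h := by
      ext g
      change f.1 g - clamp r (f.1 g) = (f.1 g - clamp r (f.1 g)) * φ (h.1 g) * φ (h.1 g) *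
        (starRingEnd ℂ) (h.1 g) * h.1 g
      rcases le_total ‖f.1 g‖ r with hg | hg
      · simp [clamp_of_norm_le hg]
      · have h1 := hA g hg
        have h0 : (‖h.1 g‖ : ℂ) ≠ 0 := by
          have : (0 : ℝ) < ‖h.1 g‖ := by linarith
          exact_mod_cast this.ne'
        rw [mul_assoc _ ((starRingEnd ℂ) _), Complex.conj_mul']
        simp only [φ, max_eq_left h1]
        push_cast
        field_simp
    rw [e]
    exact mul_mem_boundedClosure hgen _ hh
  -- The truncations at height 1/(n+1) tend to 0 in D_p(G), so f is a limit of elements of the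
  -- ideal.
  change BDp.toDp f ∈ closure (finSupp S p)
  refine (isClosed_closure (s := finSupp S p)).mem_of_tendsto
    (f := fun n : ℕ => BDp.toDp (f - (BDp.toDp f).trunc
      (Nat.one_div_pos_of_nat (α := ℝ) (n := n)).le)) (b := atTop) ?_
    (Eventually.of_forall fun n => key _ Nat.one_div_pos_of_nat)
  have := (tendsto_const_nhds (x := BDp.toDp f)).sub (BDp.toDp f).tendsto_trunc_zero
  rw [sub_zero] at this
  exact this

/-! ### The main theorem -/

theorem toDp_one_mem_constants : BDp.toDp (1 : BDp S p) ∈ constants S p := ⟨1, fun _ => rfl⟩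

theorem closure_eq_top_of_subsingleton (hgen : Subgroup.closure (S : Set G) = ⊤)
    (hsub : (harmonicBoundary S p).Subsingleton) :
    (ellp S p ⊔ constants S p).topologicalClosure = ⊤ := by
  set W := (ellp S p ⊔ constants S p).topologicalClosure
  have hW : IsClosed (W : Set (Dp S p)) := Submodule.isClosed_topologicalClosure _
  have hle : ellp S p ⊔ constants S p ≤ W := Submodule.le_topologicalClosure _
  have hK : ∀ f ∈ boundedClosure S p, BDp.toDp f ∈ W := fun f hf =>
    closure_minimal (fun u hu => hle (Submodule.mem_sup_left (finSupp_subset_ellp hu))) hW hf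
  have hb : ∀ f : BDp S p, BDp.toDp f ∈ W := by
    intro f
    rcases hsub.eq_empty_or_singleton with h0 | ⟨x, hx⟩
    · exact hK f (mem_boundedClosure_of_forall hgen (by simp [h0]))
    · have h1 : f - x.1 f • 1 ∈ boundedClosure S p := by
        refine mem_boundedClosure_of_forall hgen fun y hy => ?_
        rw [hx, Set.mem_singleton_iff] at hy
        subst hy
        rw [map_sub, map_smul, Spectrum.map_one, smul_eq_mul, mul_one, sub_self]
      have h2 := W.add_mem (hK _ h1) (W.smul_mem (x.1 f)
        (hle (Submodule.mem_sup_right toDp_one_mem_constants)))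
      have h3 : BDp.toDp (f - x.1 f • 1) + x.1 f • BDp.toDp 1 = BDp.toDp f :=
        sub_add_cancel (BDp.toDp f) (x.1 f • BDp.toDp 1)
      rwa [h3] at h2
  exact eq_top_iff.2 fun f _ =>
    hW.mem_of_tendsto f.tendsto_trunc_nat (Eventually.of_forall fun n => hb _)

theorem constants_le_span : constants S p ≤ Submodule.span ℂ {BDp.toDp (1 : BDp S p)} := by
  rintro f ⟨c, hc⟩
  refine Submodule.mem_span_singleton.2 ⟨c, Subtype.ext (funext fun g => ?_)⟩
  exact (mul_one c).trans (hc g).symm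

theorem subsingleton_of_closure_eq_top
    (htop : (ellp S p ⊔ constants S p).topologicalClosure = ⊤) :
    (harmonicBoundary S p).Subsingleton := by
  set L := Submodule.span ℂ {BDp.toDp (1 : BDp S p)}
  -- A closed subspace plus a finite-dimensional one is closed, so no further closure is needed
  -- after adding the constants.
  have hcl : IsClosed ((closureFinSupp S p ⊔ L : Submodule ℂ (Dp S p)) : Set (Dp S p)) :=
    Submodule.isClosed_sup_finiteDimensional _ _ isClosed_closureFinSupp
  have hle : (ellp S p ⊔ constants S p).topologicalClosure ≤ closureFinSupp S p ⊔ L :=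
    Submodule.topologicalClosure_minimal _
      (sup_le_sup ellp_le_closureFinSupp constants_le_span) hcl
  intro x hx y hy
  refine Subtype.ext (NonUnitalAlgHom.ext fun f => ?_)
  have hf : BDp.toDp f ∈ closureFinSupp S p ⊔ L := hle (htop ▸ Submodule.mem_top)
  obtain ⟨u, hu, k, hk, huk⟩ := Submodule.mem_sup.1 hf
  obtain ⟨c, rfl⟩ := Submodule.mem_span_singleton.1 hk
  have hI : f - c • 1 ∈ boundedClosure S p := by
    have : BDp.toDp (f - c • 1) = u := (eq_sub_of_add_eq huk).symm
    change BDp.toDp (f - c • 1) ∈ closure (finSupp S p)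
    rwa [this]
  have val : ∀ z ∈ harmonicBoundary S p, z.1 f = c := fun z hz => by
    have := hz.2 _ hI
    rwa [map_sub, map_smul, Spectrum.map_one, smul_eq_mul, mul_one, sub_eq_zero] at this
  rw [val x hx, val y hy]

end PHarmonic

theorem theorem2p2 {G : Type*} [Group G] [Infinite G] (S : Finset G)
    (hsymm : ∀ s ∈ S, s⁻¹ ∈ S) (hgen : Subgroup.closure (S : Set G) = ⊤)
    (p : ℝ) [Fact (1 ≤ p)] (hp : 1 < p) :
    Nontrivial (PHarmonic.ReducedCohomology S p) ↔
      1 < (PHarmonic.harmonicBoundary S p).encard := by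
  rw [Submodule.Quotient.nontrivial_iff, Set.one_lt_encard_iff_nontrivial,
    ← Set.not_subsingleton_iff, not_iff_not]
  exact ⟨PHarmonic.subsingleton_of_closure_eq_top,
    PHarmonic.closure_eq_top_of_subsingleton hgen⟩
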